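/- Let $\mathcal E$ be the set of all (weakly) decreasing functions $f\colon[0,1]\to[0,1]$ with $f(0)=1$ and $\int_0^1 f>0$. For $f\in\mathcal E$ define its pseudo-inverse $f^*(y):=\sup\{x\in[0,1] : f(x)\ge y\}$ for $y\in[0,1]$, and define $$(Tf)(x):=\frac{\int_x^1 f^*(t)\,dt}{\int_0^1 f^*(t)\,dt}\qquad (x\in[0,1]).$$ Call a differentiable bijection $g\colon[0,1]\to[0,1]$ (with one-sided derivatives at the endpoints) a unit stribola if there is $\gamma>0$ with $-\gamma g'=g^{-1}$ on $[0,1]$, where $g^{-1}$ is the compositional inverse. Theorem. There is exactly one unit stribola $h$. It belongs to $\mathcal E$, satisfies $Th=h$, and is the uniform limit on $[0,1]$ of the iterates $T^n1$ of the constant function $1$. Moreover, for every $f\in\mathcal E$, the iterates $T^nf$ converge to $h$ uniformly on $[0,1]$ as $n\to\infty$; that is, $h$ is a global attractor of $T$. -/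

import Mathlib

open Set Filter Topology MeasureTheory

noncomputable section

namespace Stribola

/-- The unit interval `[0,1]`. Functions on `[0,1]` are represented by functions `ℝ → ℝ` of which
only the values on `I01` matter. -/
def I01 : Set ℝ := Icc 0 1

/-- The area `∫₀¹ f`. -/
def area (f : ℝ → ℝ) : ℝ := ∫ x in (0 : ℝ)..1, f x

/-- The class of (weakly) decreasing functions `f : [0,1] → [0,∞)` with `f 0 = 1` and positive
area. Such functions automatically have values in `[0,1]` and are measurable and integrable. -/
structure MemE (f : ℝ → ℝ) : Prop where
  nonneg : ∀ x ∈ I01, 0 ≤ f x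
  antitone : AntitoneOn f I01
  map_zero : f 0 = 1
  area_pos : 0 < area f

/-- The pseudo-inverse `f* y = sup {x ∈ [0,1] | f x ≥ y}`. -/
def pseudoInv (f : ℝ → ℝ) (y : ℝ) : ℝ := sSup {x | x ∈ I01 ∧ y ≤ f x}

/-- The operator `(I g) x = (∫ₓ¹ g) / ∫₀¹ g`. -/
def opI (g : ℝ → ℝ) (x : ℝ) : ℝ := (∫ t in x..1, g t) / area g

/-- The operator `T f = I f*`. -/
def opT (f : ℝ → ℝ) : ℝ → ℝ := opI (pseudoInv f)

/-- A unit stribola: a differentiable bijection `g` of `[0,1]` onto itself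
with `-γ g' = g⁻¹` on `[0,1]` for some `γ > 0` (one-sided derivatives at the endpoints). -/
structure IsUnitStribola (g : ℝ → ℝ) : Prop where
  bijOn : BijOn g I01 I01
  differentiableOn : DifferentiableOn ℝ g I01
  eqn : ∃ γ : ℝ, 0 < γ ∧ ∀ x ∈ I01, -γ * derivWithin g I01 x = Function.invFunOn g I01 x

end Stribola

end

namespace Stribola

/-! The engine is a variation-diminishing property of `T`. Compare `TF` with a rescaled copy `m * TG
(x / l)`. Up to a constant factor, the derivative of their difference is `k * G* (t / l) - F* t`
with `k = pullScale F G l m`, and `k * G* (t / l)` is the pseudo-inverse of `l * G (z / k)`. So a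
sign pattern of the difference after `T` pulls back to one of `F - l * G (· / k)`, read in reverse
order. The palindromic pattern `-, +, -` is therefore never created (`Prec.opT`). It is absent when
`G` is the constant `1`, hence between `T^n F` and `T^n 1` for all `n`.

One consequence is `T^n F ≤ T^n 1` (`iterate_le_iterate_top`), so `T^n 1` decreases to a limit. The
other concerns lower bounds: if `T^n F` falls below the copy of `T^n 1` with scales `l, m < 1`, then
one step earlier it does so with scales `k, l < 1`. In logarithms, differences between two such
pairs of scales obey a Fibonacci recursion and grow backwards in time. But the horizontal scales
stay in a fixed interval `(a, 1)`, because coareas are bounded below along orbits. Hence for any `p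
< 1` the copy with scales `p, p` eventually lies below `T^n F` (`eventually_mul_iterate_top_le`),
which squeezes `T^n F` against `T^n 1`.

The limit is a fixed point of `T`, and differentiating the fixed point equation makes it a unit
stribola. Conversely every unit stribola is a fixed point of `T`, so attraction gives uniqueness. -/

/-! ### Pseudo-inverses and elementary bounds on `T`. -/

lemma bddAbove_superlevel (f : ℝ → ℝ) (y : ℝ) : BddAbove {x | x ∈ I01 ∧ y ≤ f x} :=
  ⟨1, fun _ hx => hx.1.2⟩

lemma pseudoInv_nonneg (f : ℝ → ℝ) (y : ℝ) : 0 ≤ pseudoInv f y :=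
  Real.sSup_nonneg fun _ hx => hx.1.1

lemma pseudoInv_le_one (f : ℝ → ℝ) (y : ℝ) : pseudoInv f y ≤ 1 :=
  Real.sSup_le (fun _ hx => hx.1.2) zero_le_one

lemma le_pseudoInv {f : ℝ → ℝ} {x y : ℝ} (hx : x ∈ I01) (h : y ≤ f x) : x ≤ pseudoInv f y :=
  le_csSup (bddAbove_superlevel f y) ⟨hx, h⟩

lemma pseudoInv_mono {f g : ℝ → ℝ} (h : ∀ x ∈ I01, f x ≤ g x) (y : ℝ) :
    pseudoInv f y ≤ pseudoInv g y :=
  Real.sSup_le (fun _ hx => le_pseudoInv hx.1 (hx.2.trans (h _ hx.1))) (pseudoInv_nonneg g y)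

lemma pseudoInv_congr {f g : ℝ → ℝ} (h : EqOn f g I01) : pseudoInv f = pseudoInv g :=
  funext fun y => le_antisymm (pseudoInv_mono (fun _ hx => (h hx).le) y)
    (pseudoInv_mono (fun _ hx => (h hx).ge) y)

lemma opT_congr {f g : ℝ → ℝ} (h : EqOn f g I01) : opT f = opT g := by
  unfold opT; rw [pseudoInv_congr h]

lemma antitone_pseudoInv (f : ℝ → ℝ) : Antitone (pseudoInv f) := fun _ _ hy =>
  Real.sSup_le (fun _ hx => le_pseudoInv hx.1 (hy.trans hx.2)) (pseudoInv_nonneg f _)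

lemma exists_of_lt_pseudoInv {f : ℝ → ℝ} {a y : ℝ} (ha : 0 ≤ a) (h : a < pseudoInv f y) :
    ∃ x ∈ I01, y ≤ f x ∧ a < x := by
  have hne : {x | x ∈ I01 ∧ y ≤ f x}.Nonempty := by
    by_contra hne
    rw [not_nonempty_iff_eq_empty] at hne
    rw [pseudoInv, hne, Real.sSup_empty] at h
    exact absurd h ha.not_gt
  obtain ⟨x, hx, hax⟩ := exists_lt_of_lt_csSup hne h
  exact ⟨x, hx.1, hx.2, hax⟩

lemma pseudoInv_eq_zero {f : ℝ → ℝ} (hf : ∀ x ∈ I01, f x ≤ 1) {y : ℝ} (hy : 1 < y) :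
    pseudoInv f y = 0 := by
  by_contra h
  obtain ⟨x, hx, hyx, -⟩ := exists_of_lt_pseudoInv le_rfl
    ((pseudoInv_nonneg f y).lt_of_ne (Ne.symm h))
  linarith [hf x hx]

lemma intervalIntegrable_pseudoInv (f : ℝ → ℝ) (a b : ℝ) :
    IntervalIntegrable (pseudoInv f) volume a b :=
  (antitone_pseudoInv f).intervalIntegrable

/-- The area under the pseudo-inverse, which normalizes `opT f`. -/
noncomputable def coarea (f : ℝ → ℝ) : ℝ := area (pseudoInv f)

lemma opT_apply (f : ℝ → ℝ) (x : ℝ) : opT f x = (∫ t in x..1, pseudoInv f t) / coarea f := rfl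

lemma opT_sub (f : ℝ → ℝ) (x y : ℝ) :
    opT f x - opT f y = (∫ t in x..y, pseudoInv f t) / coarea f := by
  rw [opT_apply, opT_apply, ← sub_div, ← intervalIntegral.integral_add_adjacent_intervals
    (intervalIntegrable_pseudoInv f x y) (intervalIntegrable_pseudoInv f y 1), add_sub_cancel_right]

lemma opT_one (f : ℝ → ℝ) : opT f 1 = 0 := by simp [opT_apply]

lemma coarea_le_one (f : ℝ → ℝ) : coarea f ≤ 1 := by
  have := intervalIntegral.integral_mono (μ := volume) zero_le_one
    (intervalIntegrable_pseudoInv f 0 1) (intervalIntegrable_const (c := (1 : ℝ)))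
    (pseudoInv_le_one f)
  simpa [coarea, area] using this

lemma mul_sub_le_integral_pseudoInv {f : ℝ → ℝ} {x y z : ℝ} (hx : x ∈ I01) (hzy : z ≤ y)
    (hy : y ≤ 1) (h : y ≤ f x) : x * (y - z) ≤ ∫ t in z..1, pseudoInv f t := by
  rw [← intervalIntegral.integral_add_adjacent_intervals
    (intervalIntegrable_pseudoInv f z y) (intervalIntegrable_pseudoInv f y 1)]
  have h1 := intervalIntegral.integral_mono_on (μ := volume) hzy
    (intervalIntegrable_const (c := x)) (intervalIntegrable_pseudoInv f z y)
    (fun t ht => le_pseudoInv hx (ht.2.trans h))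
  have h2 := intervalIntegral.integral_nonneg (μ := volume) hy
    (fun t _ => pseudoInv_nonneg f t)
  simp only [intervalIntegral.integral_const, smul_eq_mul] at h1
  linarith

lemma mul_le_coarea {f : ℝ → ℝ} {x y : ℝ} (hx : x ∈ I01) (hy : y ∈ I01) (h : y ≤ f x) :
    x * y ≤ coarea f := by
  simpa [coarea, area] using mul_sub_le_integral_pseudoInv hx hy.1 hy.2 h

/-! ### Profiles, the class in which the orbits live. -/

/-- Decreasing functions on `[0,∞)` that start continuously at `1` and vanish beyond `1`. -/
structure IsProfile (F : ℝ → ℝ) : Prop where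
  anti : AntitoneOn F (Ici 0)
  map_zero : F 0 = 1
  vanish : ∀ x, 1 < x → F x = 0
  near : ∀ y < 1, ∃ x > 0, y ≤ F x

namespace IsProfile

variable {F : ℝ → ℝ}

lemma nonneg (hF : IsProfile F) {x : ℝ} (hx : 0 ≤ x) : 0 ≤ F x := by
  have := hF.anti (mem_Ici.2 hx) (mem_Ici.2 (by positivity : (0 : ℝ) ≤ x + 2))
    (by linarith : x ≤ x + 2)
  rwa [hF.vanish _ (by linarith)] at this

lemma le_one (hF : IsProfile F) {x : ℝ} (hx : 0 ≤ x) : F x ≤ 1 :=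
  hF.map_zero ▸ hF.anti (mem_Ici.2 le_rfl) (mem_Ici.2 hx) hx

lemma le_one_of_pos (hF : IsProfile F) {x : ℝ} (h : 0 < F x) : x ≤ 1 := by
  by_contra hx
  rw [hF.vanish x (not_le.1 hx)] at h
  exact lt_irrefl _ h

lemma pseudoInv_pos (hF : IsProfile F) {y : ℝ} (hy : y < 1) : 0 < pseudoInv F y := by
  have hy' : max y (1 / 2) < 1 := max_lt hy (by norm_num)
  obtain ⟨x, hx, h⟩ := hF.near _ hy'
  have : 0 < F x := lt_of_lt_of_le (by positivity) ((le_max_right y (1 / 2)).trans h)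
  exact hx.trans_le (le_pseudoInv ⟨hx.le, hF.le_one_of_pos this⟩ ((le_max_left _ _).trans h))

lemma coarea_pos (hF : IsProfile F) : 0 < coarea F := by
  obtain ⟨x, hx, h⟩ := hF.near (1 / 2) (by norm_num)
  have hx1 : x ∈ I01 := ⟨hx.le, hF.le_one_of_pos (by linarith)⟩
  have := mul_le_coarea hx1 (y := 1 / 2) ⟨by norm_num, by norm_num⟩ h
  linarith

lemma opT_pos (hF : IsProfile F) {x : ℝ} (hx1 : x < 1) : 0 < opT F x :=
  div_pos (intervalIntegral.intervalIntegral_pos_of_pos_on (intervalIntegrable_pseudoInv F x 1)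
    (fun _ ht => hF.pseudoInv_pos ht.2) hx1) hF.coarea_pos

end IsProfile

lemma opT_zero {f : ℝ → ℝ} (h : 0 < coarea f) : opT f 0 = 1 := div_self h.ne'

lemma antitone_opT (f : ℝ → ℝ) (h : 0 < coarea f) : Antitone (opT f) := fun x y hxy => by
  have := opT_sub f x y
  have h2 := intervalIntegral.integral_nonneg (μ := volume) hxy
    (fun t _ => pseudoInv_nonneg f t)
  have := div_nonneg h2 h.le
  linarith

lemma opT_sub_le {f : ℝ → ℝ} (h : 0 < coarea f) {x y : ℝ} (hxy : x ≤ y) :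
    opT f x - opT f y ≤ (y - x) / coarea f := by
  rw [opT_sub]
  gcongr
  have := intervalIntegral.integral_mono (μ := volume) hxy
    (intervalIntegrable_pseudoInv f x y) (intervalIntegrable_const (c := (1 : ℝ)))
    (pseudoInv_le_one f)
  simpa using this

lemma one_sub_div_le_opT {f : ℝ → ℝ} (h : 0 < coarea f) {x : ℝ} (hx : 0 ≤ x) :
    1 - x / coarea f ≤ opT f x := by
  have := opT_sub_le h hx
  rw [opT_zero h, sub_zero] at this
  linarith

lemma continuous_opT (f : ℝ → ℝ) : Continuous (opT f) := by
  have h : opT f = fun x => opT f 0 - (∫ t in (0 : ℝ)..x, pseudoInv f t) / coarea f := by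
    ext x; rw [← opT_sub]; ring
  rw [h]
  exact continuous_const.sub ((intervalIntegral.continuous_primitive
    (fun a b => intervalIntegrable_pseudoInv f a b) 0).div_const _)

lemma opT_eq_zero {f : ℝ → ℝ} (hf : ∀ x ∈ I01, f x ≤ 1) {x : ℝ} (hx : 1 ≤ x) : opT f x = 0 := by
  rw [opT_apply, intervalIntegral.integral_symm, intervalIntegral.integral_of_le hx,
    setIntegral_congr_fun (g := fun _ => 0) measurableSet_Ioc
      (fun t ht => pseudoInv_eq_zero hf ht.1)]
  simp

lemma isProfile_opT_of_pos {f : ℝ → ℝ} (hf : ∀ x ∈ I01, f x ≤ 1) (h : 0 < coarea f) :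
    IsProfile (opT f) where
  anti := (antitone_opT f h).antitoneOn _
  map_zero := opT_zero h
  vanish x hx := opT_eq_zero hf hx.le
  near y hy := ⟨(1 - y) * coarea f, mul_pos (by linarith) h, by
    have := one_sub_div_le_opT h (mul_pos (by linarith : 0 < 1 - y) h).le
    rw [mul_div_cancel_right₀ _ h.ne'] at this
    linarith⟩

lemma IsProfile.opT {F : ℝ → ℝ} (hF : IsProfile F) : IsProfile (opT F) :=
  isProfile_opT_of_pos (fun _ hx => hF.le_one hx.1) hF.coarea_pos

lemma IsProfile.iterate {F : ℝ → ℝ} (hF : IsProfile F) (n : ℕ) : IsProfile (Stribola.opT^[n] F) := by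
  induction n with
  | zero => exact hF
  | succ n ih => rw [Function.iterate_succ_apply']; exact ih.opT

lemma MemE.le_one {f : ℝ → ℝ} (hf : MemE f) : ∀ x ∈ I01, f x ≤ 1 := fun _ hx =>
  hf.map_zero ▸ hf.antitone ⟨le_rfl, zero_le_one⟩ hx hx.1

lemma MemE.coarea_pos {f : ℝ → ℝ} (hf : MemE f) : 0 < coarea f := by
  have : ∃ x ∈ Ioc (0 : ℝ) 1, 0 < f x := by
    by_contra! hcon
    refine hf.area_pos.ne' ?_
    rw [area, intervalIntegral.integral_of_le zero_le_one,
      setIntegral_congr_fun (g := fun _ => 0) measurableSet_Ioc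
        (fun t ht => le_antisymm (hcon t ht) (hf.nonneg t ⟨ht.1.le, ht.2⟩))]
    simp
  obtain ⟨x, hx, hfx⟩ := this
  have hxI : x ∈ I01 := ⟨hx.1.le, hx.2⟩
  exact (mul_pos hx.1 hfx).trans_le (mul_le_coarea hxI ⟨hfx.le, hf.le_one x hxI⟩ le_rfl)

/-- A member of `MemE` may jump at `0`, so it need not be a profile itself; one application of `T`
repairs this. -/
lemma MemE.isProfile_opT {f : ℝ → ℝ} (hf : MemE f) : IsProfile (opT f) :=
  isProfile_opT_of_pos hf.le_one hf.coarea_pos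

/-- The indicator of `(-∞,1]`, which is the constant function `1` as far as `opT` is concerned. -/
noncomputable def top (x : ℝ) : ℝ := if x ≤ 1 then 1 else 0

lemma top_nonneg (x : ℝ) : 0 ≤ top x := by unfold top; split_ifs <;> norm_num

lemma isProfile_top : IsProfile top where
  anti x _ y _ hxy := by
    by_cases hy : y ≤ 1
    · simp [top, hy, hxy.trans hy]
    · simpa [top, hy] using top_nonneg x
  map_zero := by simp [top]
  vanish x hx := by simp [top, hx]
  near y hy := ⟨1, one_pos, by simp [top, hy.le]⟩

lemma eqOn_top : EqOn (fun _ => 1) top I01 := fun x hx => by simp [top, hx.2]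

lemma pseudoInv_top {y : ℝ} (hy : y ≤ 1) : pseudoInv top y = 1 :=
  le_antisymm (pseudoInv_le_one _ _) (le_pseudoInv ⟨zero_le_one, le_rfl⟩ (by simp [top, hy]))

lemma opT_top {x : ℝ} (hx : x ≤ 1) : opT top x = 1 - x := by
  have key : ∀ a ≤ (1 : ℝ), ∫ t in a..1, pseudoInv top t = 1 - a := fun a ha => by
    rw [intervalIntegral.integral_congr (g := fun _ => 1)]
    · simp
    · intro t ht
      rw [uIcc_of_le ha] at ht
      exact pseudoInv_top ht.2
  rw [opT_apply, coarea, area, key x hx, key 0 zero_le_one]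
  simp

/-! ### Sign patterns under `T`. -/

variable {F G : ℝ → ℝ}

/-- `k * pseudoInv G (t / l)` is the pseudo-inverse of `l * G (· / k)`. A strict inequality between
pseudo-inverses at level `t` yields a point where `t` separates the two functions. -/
lemma exists_of_pseudoInv_lt (hF : IsProfile F) {k l t : ℝ} (hk : 0 < k) (hl : 0 < l) (ht : 0 < t)
    (h : pseudoInv F t < k * pseudoInv G (t / l)) :
    ∃ z, 0 ≤ z ∧ F z < t ∧ t ≤ l * G (z / k) := by
  have h' : pseudoInv F t / k < pseudoInv G (t / l) := by rwa [div_lt_iff₀' hk]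
  obtain ⟨x, hx, hxt, hlt⟩ :=
    exists_of_lt_pseudoInv (div_nonneg (pseudoInv_nonneg F t) hk.le) h'
  rw [div_lt_iff₀' hk] at hlt
  have h0 : 0 ≤ k * x := mul_nonneg hk.le hx.1
  refine ⟨k * x, h0, ?_, ?_⟩
  · by_contra! hcon
    exact hlt.not_ge (le_pseudoInv ⟨h0, hF.le_one_of_pos (ht.trans_le hcon)⟩ hcon)
  · rw [mul_div_cancel_left₀ _ hk.ne']
    rwa [div_le_iff₀' hl] at hxt

lemma exists_of_lt_pseudoInv_mul (hG : IsProfile G) {k l t : ℝ} (hk : 0 < k) (hl : 0 < l)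
    (ht : 0 < t) (h : k * pseudoInv G (t / l) < pseudoInv F t) :
    ∃ z, 0 ≤ z ∧ l * G (z / k) < t ∧ t ≤ F z := by
  obtain ⟨x, hx, hxt, hlt⟩ :=
    exists_of_lt_pseudoInv (mul_nonneg hk.le (pseudoInv_nonneg G (t / l))) h
  refine ⟨x, hx.1, ?_, hxt⟩
  by_contra! hcon
  rw [← div_le_iff₀' hl] at hcon
  have := le_pseudoInv ⟨div_nonneg hx.1 hk.le,
    hG.le_one_of_pos ((div_pos ht hl).trans_le hcon)⟩ hcon
  rw [div_le_iff₀' hk] at this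
  linarith

/-- The difference of `opT F` and a rescaled copy of `opT G`. -/
noncomputable def gap (F G : ℝ → ℝ) (l m x : ℝ) : ℝ := opT F x - m * opT G (x / l)

/-- The horizontal scale which corresponds to the vertical scale `m` before `opT` is applied. -/
noncomputable def pullScale (F G : ℝ → ℝ) (l m : ℝ) : ℝ := m * coarea F / (coarea G * l)

lemma pullScale_pos (hF : IsProfile F) (hG : IsProfile G) {l m : ℝ} (hl : 0 < l) (hm : 0 < m) :
    0 < pullScale F G l m :=
  div_pos (mul_pos hm hF.coarea_pos) (mul_pos hG.coarea_pos hl)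

lemma gap_sub (hF : IsProfile F) (hG : IsProfile G) {l m : ℝ} (hl : 0 < l) (x y : ℝ) :
    gap F G l m x - gap F G l m y =
      ((∫ t in x..y, pseudoInv F t) -
        ∫ t in x..y, pullScale F G l m * pseudoInv G (t / l)) / coarea F := by
  have hA := hF.coarea_pos.ne'
  have hB := hG.coarea_pos.ne'
  have : gap F G l m x - gap F G l m y =
      (opT F x - opT F y) - m * (opT G (x / l) - opT G (y / l)) := by
    unfold gap; ring
  rw [this, opT_sub, opT_sub, intervalIntegral.integral_const_mul,
    intervalIntegral.integral_comp_div _ hl.ne', pullScale, smul_eq_mul]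
  field_simp

lemma intervalIntegrable_pseudoInv_div (G : ℝ → ℝ) {k l : ℝ} (hl : 0 < l) (a b : ℝ) :
    IntervalIntegrable (fun t => k * pseudoInv G (t / l)) volume a b :=
  (Antitone.intervalIntegrable fun _ _ h => antitone_pseudoInv G (by gcongr)).const_mul k

lemma exists_lt_of_gap_lt (hF : IsProfile F) (hG : IsProfile G) {l m x y : ℝ} (hl : 0 < l)
    (hm : 0 < m) (hx : 0 ≤ x) (hxy : x ≤ y) (h : gap F G l m x < gap F G l m y) :
    ∃ t ∈ Ioo x y, ∃ z, 0 ≤ z ∧ F z < t ∧ t ≤ l * G (z / pullScale F G l m) := by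
  by_contra! hcon
  have hle := intervalIntegral.integral_mono_on_of_le_Ioo hxy
    (intervalIntegrable_pseudoInv_div G (k := pullScale F G l m) hl x y)
    (intervalIntegrable_pseudoInv F x y) (fun t ht => by
      by_contra! hlt
      obtain ⟨z, hz, h1, h2⟩ :=
        exists_of_pseudoInv_lt hF (pullScale_pos hF hG hl hm) hl (hx.trans_lt ht.1) hlt
      exact h2.not_gt (hcon t ht z hz h1))
  have := gap_sub hF hG (m := m) hl x y
  have := div_nonneg (sub_nonneg.2 hle) hF.coarea_pos.le
  linarith

lemma exists_lt_of_lt_gap (hF : IsProfile F) (hG : IsProfile G) {l m x y : ℝ} (hl : 0 < l)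
    (hm : 0 < m) (hx : 0 ≤ x) (hxy : x ≤ y) (h : gap F G l m y < gap F G l m x) :
    ∃ t ∈ Ioo x y, ∃ z, 0 ≤ z ∧ l * G (z / pullScale F G l m) < t ∧ t ≤ F z := by
  by_contra! hcon
  have hle := intervalIntegral.integral_mono_on_of_le_Ioo hxy
    (intervalIntegrable_pseudoInv F x y)
    (intervalIntegrable_pseudoInv_div G (k := pullScale F G l m) hl x y) (fun t ht => by
      by_contra! hlt
      obtain ⟨z, hz, h1, h2⟩ :=
        exists_of_lt_pseudoInv_mul hG (pullScale_pos hF hG hl hm) hl (hx.trans_lt ht.1) hlt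
      exact h2.not_gt (hcon t ht z hz h1))
  have := gap_sub hF hG (m := m) hl x y
  have := div_nonneg (sub_nonneg.2 hle) hF.coarea_pos.le
  rw [← neg_sub, neg_div] at *
  linarith

/-- `F - m G(·/l)` never takes signs `-`, `+`, `-` in this order, whatever the scales. -/
def Prec (F G : ℝ → ℝ) : Prop :=
  ∀ l > 0, ∀ m > 0, ∀ x y z, 0 ≤ x → x < y → y < z →
    F x < m * G (x / l) → m * G (y / l) < F y → m * G (z / l) ≤ F z

lemma lt_of_antitoneOn_of_apply_lt {F : ℝ → ℝ} (hF : AntitoneOn F (Ici 0)) {x y : ℝ} (hx : 0 ≤ x)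
    (hy : 0 ≤ y) (h : F x < F y) : y < x := by
  by_contra! hxy
  exact (hF hx hy hxy).not_gt h

lemma IsProfile.antitoneOn_scale (hG : IsProfile G) {k l : ℝ} (hk : 0 < k) (hl : 0 < l) :
    AntitoneOn (fun x => l * G (x / k)) (Ici 0) := fun x hx y hy hxy =>
  mul_le_mul_of_nonneg_left (hG.anti (div_nonneg hx hk.le) (div_nonneg hy hk.le) (by gcongr)) hl.le

/-- A pattern `-, +, -` followed by the final value `0` makes the gap rise, fall and rise. This
gives levels `t₁ < t₂ < t₃` at which the pseudo-inverses compare as `-, +, -`, and monotonicity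
turns them into points `z₃ < z₂ < z₁` with the same pattern. -/
lemma Prec.opT (hF : IsProfile F) (hG : IsProfile G) (h : Prec F G) : Prec (opT F) (opT G) := by
  intro l hl m hm x y z hx hxy hyz h1 h2
  by_contra! h3
  -- Both profiles vanish here: the argument is at least `1` and at least `l`.
  have hend : gap F G l m (max z (max 1 l)) = 0 := by
    rw [gap, opT_eq_zero (fun _ hx => hF.le_one hx.1) (by simp),
      opT_eq_zero (fun _ hx => hG.le_one hx.1) (by rw [le_div_iff₀ hl]; simp)]
    ring
  obtain ⟨t₁, ht₁, z₁, hz₁, a₁, b₁⟩ := exists_lt_of_gap_lt hF hG hl hm hx hxy.le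
    (by unfold gap; linarith)
  obtain ⟨t₂, ht₂, z₂, hz₂, a₂, b₂⟩ := exists_lt_of_lt_gap hF hG hl hm (hx.trans hxy.le) hyz.le
    (by unfold gap; linarith)
  obtain ⟨t₃, ht₃, z₃, hz₃, a₃, b₃⟩ := exists_lt_of_gap_lt (y := max z (max 1 l)) hF hG hl hm
    (hx.trans (hxy.trans hyz).le) (le_max_left _ _) (by rw [hend]; unfold gap; linarith)
  have hk := pullScale_pos hF hG hl hm
  have h21 : z₂ < z₁ := lt_of_antitoneOn_of_apply_lt hF.anti hz₁ hz₂ (by linarith [ht₁.2, ht₂.1])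
  have h32 : z₃ < z₂ := lt_of_antitoneOn_of_apply_lt (hG.antitoneOn_scale hk hl) hz₂ hz₃
    (by linarith [ht₂.2, ht₃.1])
  have := h _ hk l hl z₃ z₂ z₁ hz₃ h32 h21 (by linarith) (by linarith)
  linarith

lemma Prec.iterate (hF : IsProfile F) (hG : IsProfile G) (h : Prec F G) (n : ℕ) :
    Prec (Stribola.opT^[n] F) (Stribola.opT^[n] G) := by
  induction n with
  | zero => exact h
  | succ n ih =>
    rw [Function.iterate_succ_apply', Function.iterate_succ_apply']
    exact ih.opT (hF.iterate n) (hG.iterate n)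

/-- Up to `l` the copy of `top` is constant, so the difference decreases and cannot pass from `-` to
`+`; beyond `l` it is just `F ≥ 0`. -/
lemma prec_top (hF : IsProfile F) : Prec F top := by
  intro l hl m hm x y z hx hxy hyz h1 h2
  have hly : l < y := by
    by_contra! hy
    have e1 : top (y / l) = 1 := by simp [top, div_le_one hl, hy]
    have e2 : top (x / l) = 1 := by simp [top, div_le_one hl, hxy.le.trans hy]
    rw [e1] at h2
    rw [e2] at h1
    exact absurd (hF.anti hx (hx.trans hxy.le) hxy.le) (by linarith)
  rw [isProfile_top.vanish _ ((one_lt_div hl).2 (hly.trans hyz)), mul_zero]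
  exact hF.nonneg (by linarith)

/-- If `F` exceeded the enlarged copy `r * G (· / r)`, `r > 1`, at some `x`, the points `0, x, 1`
would show `-, +, -`. Then let `r` tend to `1`. -/
lemma Prec.le (hF : IsProfile F) (hG : IsProfile G) (hF1 : F 1 = 0) (hGc : Continuous G)
    (hG1 : ∀ x < 1, 0 < G x) (h : Prec F G) {x : ℝ} (hx : 0 ≤ x) : F x ≤ G x := by
  have key : ∀ r > 1, F x ≤ r * G (x / r) := by
    intro r hr
    have hr0 : 0 < r := by linarith
    by_contra! hcon
    have hx0 : 0 < x := by
      refine hx.lt_of_ne fun h0 => ?_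
      rw [← h0, zero_div, hF.map_zero, hG.map_zero] at hcon
      linarith
    have hx1 : x < 1 := by
      by_contra! h1
      have := hF.anti (mem_Ici.2 zero_le_one) hx h1
      have := mul_nonneg hr0.le (hG.nonneg (div_nonneg hx hr0.le))
      linarith
    have := h r hr0 r hr0 0 x 1 le_rfl hx0 hx1
      (by rw [zero_div, hF.map_zero, hG.map_zero]; linarith) hcon
    have := mul_pos hr0 (hG1 (1 / r) (by rwa [div_lt_one hr0]))
    linarith
  have hc : ContinuousAt (fun r => r * G (x / r)) 1 :=
    continuousAt_id.mul (hGc.continuousAt.comp (continuousAt_const.div continuousAt_id one_ne_zero))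
  have ht : Tendsto (fun r => r * G (x / r)) (𝓝[>] 1) (𝓝 (G x)) := by
    have := hc.tendsto.mono_left (nhdsWithin_le_nhds (s := Ioi 1))
    simpa using this
  exact ge_of_tendsto ht (eventually_nhdsWithin_of_forall key)

/-- One backward step for the scales. If the new scale `k` exceeded `1`, the pulled back signs `-,
+` would be followed by a `-` between `1` and `k`, where `F` vanishes and the copy of `G` does not.
-/
lemma pullScale_lt_one_and_exists (hF : IsProfile F) (hG : IsProfile G) (hG1 : ∀ x < 1, 0 < G x)
    (h : Prec F G) {l m x : ℝ} (hl : 0 < l) (hl1 : l < 1) (hm : 0 < m) (hm1 : m < 1) (hx : 0 ≤ x)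
    (hbad : opT F x < m * opT G (x / l)) :
    pullScale F G l m < 1 ∧ ∃ z, 0 ≤ z ∧ F z < l * G (z / pullScale F G l m) := by
  have hpos : 0 < opT G (x / l) := by
    have := hF.opT.nonneg hx
    by_contra! hcon
    have := mul_nonpos_of_nonneg_of_nonpos hm.le hcon
    linarith
  have hxl : x < l := by
    by_contra! hcon
    rw [opT_eq_zero (fun _ hx => hG.le_one hx.1) ((one_le_div hl).2 hcon)] at hpos
    exact lt_irrefl _ hpos
  have key : ∀ m, 0 < m → m < 1 → opT F x < m * opT G (x / l) →
      pullScale F G l m ≤ 1 ∧ ∃ z, 0 ≤ z ∧ F z < l * G (z / pullScale F G l m) := by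
    intro m hm hm1 hbad
    have hk := pullScale_pos hF hG hl hm
    have g0 : 0 < gap F G l m 0 := by
      rw [gap, zero_div, opT_zero hF.coarea_pos, opT_zero hG.coarea_pos]; linarith
    have gx : gap F G l m x < 0 := by unfold gap; linarith
    have gy : 0 < gap F G l m ((l + 1) / 2) := by
      rw [gap, opT_eq_zero (fun _ hx => hG.le_one hx.1)
        (by rw [one_le_div hl]; linarith : 1 ≤ (l + 1) / 2 / l)]
      have := hF.opT_pos (x := (l + 1) / 2) (by linarith)
      linarith
    have g1 : gap F G l m 1 = 0 := by
      rw [gap, opT_one, opT_eq_zero (fun _ hx => hG.le_one hx.1) ((one_le_div hl).2 hl1.le)]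
      ring
    obtain ⟨t₁, ht₁, z₁, hz₁, a₁, b₁⟩ := exists_lt_of_lt_gap hF hG hl hm le_rfl hx (gx.trans g0)
    obtain ⟨t₂, ht₂, z₂, hz₂, a₂, b₂⟩ := exists_lt_of_gap_lt (y := (l + 1) / 2) hF hG hl hm hx
      (by linarith) (gx.trans gy)
    obtain ⟨t₃, ht₃, z₃, hz₃, a₃, b₃⟩ := exists_lt_of_lt_gap (x := (l + 1) / 2) (y := 1) hF hG hl
      hm (by linarith) (by linarith) (by rw [g1]; exact gy)
    refine ⟨?_, z₂, hz₂, by linarith⟩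
    by_contra! hk1
    have h21 : z₂ < z₁ := lt_of_antitoneOn_of_apply_lt (hG.antitoneOn_scale hk hl) hz₁ hz₂
      (by linarith [ht₁.2, ht₂.1])
    have hz₁1 : z₁ ≤ 1 := hF.le_one_of_pos (by linarith [ht₁.1])
    have := h _ hk l hl z₂ z₁ ((pullScale F G l m + 1) / 2) hz₂ h21 (by linarith) (by linarith)
      (by linarith)
    rw [hF.vanish _ (by linarith)] at this
    have := mul_pos hl (hG1 ((pullScale F G l m + 1) / 2 / pullScale F G l m)
      (by rw [div_lt_one hk]; linarith))
    linarith
  refine ⟨?_, (key m hm hm1 hbad).2⟩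
  -- The larger vertical scale `(m + 1) / 2` is still bad, and `pullScale` is strictly increasing in
  -- `m`, so `≤ 1` improves to `< 1`.
  have := (key ((m + 1) / 2) (by linarith) (by linarith)
    (hbad.trans (mul_lt_mul_of_pos_right (by linarith) hpos))).1
  refine lt_of_lt_of_le ?_ this
  unfold pullScale
  have := hF.coarea_pos
  have := hG.coarea_pos
  gcongr
  linarith

/-! ### Comparison with the iterates of the constant function. -/

lemma iterate_top_pos (n : ℕ) {x : ℝ} (hx : x < 1) : 0 < opT^[n] top x := by
  cases n with
  | zero => simp [top, hx.le]
  | succ n =>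
    rw [Function.iterate_succ_apply']
    exact (isProfile_top.iterate n).opT_pos hx

lemma prec_iterate (hF : IsProfile F) (n : ℕ) : Prec (opT^[n] F) (opT^[n] top) :=
  (prec_top hF).iterate hF isProfile_top n

lemma iterate_le_iterate_top (hF : IsProfile F) (n : ℕ) {x : ℝ} (hx : 0 ≤ x) :
    opT^[n] F x ≤ opT^[n] top x := by
  cases n with
  | zero =>
    by_cases h1 : x ≤ 1
    · simpa [top, h1] using hF.le_one hx
    · simp [top, h1, hF.vanish x (not_le.1 h1)]
  | succ n =>
    refine Prec.le (hF.iterate _) (isProfile_top.iterate _) ?_ ?_ (fun y hy => iterate_top_pos _ hy)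
      (prec_iterate hF _) hx
    · rw [Function.iterate_succ_apply']; exact opT_one _
    · rw [Function.iterate_succ_apply']; exact continuous_opT _

lemma iterate_top_succ_le (n : ℕ) {x : ℝ} (hx : 0 ≤ x) :
    opT^[n + 1] top x ≤ opT^[n] top x := by
  rw [Function.iterate_succ_apply]
  exact iterate_le_iterate_top isProfile_top.opT n hx

lemma antitone_iterate_top {x : ℝ} (hx : 0 ≤ x) : Antitone fun n => opT^[n] top x :=
  antitone_nat_of_succ_le fun n => iterate_top_succ_le n hx

lemma iterate_top_le_one_sub {n : ℕ} (hn : 1 ≤ n) {x : ℝ} (hx : x ∈ I01) :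
    opT^[n] top x ≤ 1 - x := by
  have := antitone_iterate_top hx.1 hn
  simpa [opT_top hx.2] using this

/-! ### Lower bound for the coareas along an orbit. -/

lemma half_le_opT (hF : IsProfile F) : 1 / 2 ≤ opT F (coarea F / 2) := by
  have hA := hF.coarea_pos
  have := one_sub_div_le_opT hA (x := coarea F / 2) (by positivity)
  rw [div_right_comm, div_self hA.ne'] at this
  linarith

lemma coarea_half_mem (hF : IsProfile F) : coarea F / 2 ∈ I01 :=
  ⟨by linarith [hF.coarea_pos], by linarith [coarea_le_one F]⟩

lemma coarea_div_four_le (hF : IsProfile F) : coarea F / 4 ≤ coarea (opT F) := by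
  have := mul_le_coarea (coarea_half_mem hF) (y := 1 / 2) ⟨by norm_num, by norm_num⟩
    (half_le_opT hF)
  linarith

/-- On `[1/4, 1/2]` the pseudo-inverse of `TF` is at least `coarea F / 2`. This bounds `T²F (1/4)`
from below, and the rectangle of width `1/4` under the graph of `T²F` gives the estimate. -/
lemma coarea_div_le (hF : IsProfile F) :
    coarea F / (32 * coarea (opT F)) ≤ coarea (opT (opT F)) := by
  have hA := hF.opT.coarea_pos
  have hB := hF.coarea_pos
  have h1 := mul_sub_le_integral_pseudoInv (z := 1 / 4) (coarea_half_mem hF)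
    (by norm_num) (by norm_num) (half_le_opT hF)
  have h2 : coarea F / (8 * coarea (opT F)) ≤ opT (opT F) (1 / 4) := by
    rw [opT_apply, div_le_div_iff₀ (by positivity) hA]
    nlinarith
  have h3 := hF.opT.opT.le_one (x := 1 / 4) (by norm_num)
  have := mul_le_coarea (x := 1 / 4) ⟨by norm_num, by norm_num⟩ ⟨by positivity, h2.trans h3⟩ h2
  calc _ = 1 / 4 * (coarea F / (8 * coarea (opT F))) := by field_simp; norm_num
    _ ≤ _ := this

lemma exists_le_coarea_iterate (hF : IsProfile F) :
    ∃ a, 0 < a ∧ ∀ n, a ≤ coarea (opT^[n] F) := by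
  have h0 := hF.coarea_pos
  have h1 := hF.opT.coarea_pos
  refine ⟨min (min (coarea F) (coarea (opT F))) (1 / 128), by positivity, fun n => ?_⟩
  have key : ∀ n, min (min (coarea F) (coarea (opT F))) (1 / 128) ≤ coarea (opT^[n] F) ∧
      min (min (coarea F) (coarea (opT F))) (1 / 128) ≤ coarea (opT^[n + 1] F) := by
    intro n
    induction n with
    | zero => exact ⟨(min_le_left _ _).trans (min_le_left _ _),
        (min_le_left _ _).trans (min_le_right _ _)⟩
    | succ n ih =>
      refine ⟨ih.2, ?_⟩
      have hP := hF.iterate n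
      have e4 := coarea_div_four_le hP.opT
      have e32 := coarea_div_le hP
      have hA := hP.opT.coarea_pos
      rw [Function.iterate_succ_apply', Function.iterate_succ_apply']
      -- A coarea of at most `1/32` is followed by one no smaller than its predecessor; otherwise
      -- the next is at least `1/32 / 4`.
      by_cases hc : coarea (opT (opT^[n] F)) ≤ 1 / 32
      · refine ih.1.trans (le_trans ?_ e32)
        exact le_div_self hP.coarea_pos.le (by positivity) (by linarith)
      · exact (min_le_right _ _).trans (by linarith)
  exact (key n).1

/-! ### Backward dynamics of the scales. -/

/-- The profile `opT^[n] F` falls below the copy of `opT^[n] top` with scales `l` and `m`. -/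
def FallsBelow (F : ℝ → ℝ) (n : ℕ) (l m : ℝ) : Prop :=
  ∃ x, 0 ≤ x ∧ opT^[n] F x < m * opT^[n] top (x / l)

lemma FallsBelow.pred (hF : IsProfile F) {n : ℕ} {l m : ℝ} (hl : 0 < l) (hl1 : l < 1)
    (hm : 0 < m) (hm1 : m < 1) (h : FallsBelow F (n + 1) l m) :
    pullScale (opT^[n] F) (opT^[n] top) l m < 1 ∧
      FallsBelow F n (pullScale (opT^[n] F) (opT^[n] top) l m) l := by
  obtain ⟨x, hx, h⟩ := h
  rw [Function.iterate_succ_apply', Function.iterate_succ_apply'] at h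
  exact pullScale_lt_one_and_exists (hF.iterate n) (isProfile_top.iterate n)
    (fun y hy => iterate_top_pos n hy) (prec_iterate hF n) hl hl1 hm hm1 hx h

/-- The line `1 - x / a` separates the two: iterates of `top` are at most `1 - x`, and `T^(n+1) F`
descends from `1` with slope at most `1 / a`. -/
lemma iterate_top_div_le (hF : IsProfile F) {a : ℝ} (ha : 0 < a)
    (hA : ∀ n, a ≤ coarea (opT^[n] F)) (n : ℕ) {x : ℝ} (hx : 0 ≤ x) :
    opT^[n + 1] top (x / a) ≤ opT^[n + 1] F x := by
  by_cases h : x ≤ a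
  · refine (iterate_top_le_one_sub (by omega)
      ⟨div_nonneg hx ha.le, (div_le_one ha).2 h⟩).trans ?_
    rw [Function.iterate_succ_apply']
    refine le_trans ?_ (one_sub_div_le_opT (hF.iterate n).coarea_pos hx)
    gcongr
    exact hA n
  · rw [(isProfile_top.iterate (n + 1)).vanish _ ((one_lt_div ha).2 (not_le.1 h))]
    exact (hF.iterate (n + 1)).nonneg hx

lemma FallsBelow.lt_left (hF : IsProfile F) {a : ℝ} (ha : 0 < a)
    (hA : ∀ n, a ≤ coarea (opT^[n] F)) {n : ℕ} {l m : ℝ} (hl : 0 < l) (hm1 : m < 1)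
    (h : FallsBelow F (n + 1) l m) : a < l := by
  by_contra! hla
  obtain ⟨x, hx, h⟩ := h
  have hP := isProfile_top.iterate (n + 1)
  have h1 := hP.anti (div_nonneg hx ha.le) (div_nonneg hx hl.le)
    (div_le_div_of_nonneg_left hx hl hla)
  have h2 := iterate_top_div_le hF ha hA n hx
  have h3 := hP.nonneg (div_nonneg hx hl.le)
  nlinarith

/-- Two pairs of scales at which the profile falls below are driven apart backwards in time. -/
lemma fib_mul_log_le (hF : IsProfile F) {a : ℝ} (ha : 0 < a)
    (hA : ∀ n, a ≤ coarea (opT^[n] F)) (j : ℕ) : ∀ l m l' m' : ℝ, 0 < l' → l' ≤ l → l < 1 →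
    0 < m → m ≤ m' → m' < 1 → FallsBelow F (j + 1) l m → FallsBelow F (j + 1) l' m' →
    Nat.fib (j + 1) * (Real.log l - Real.log l') + Nat.fib j * (Real.log m' - Real.log m) ≤
      -Real.log a := by
  induction j with
  | zero =>
    intro l m l' m' hl' hll hl hm hmm hm' _ h'
    have h1 := Real.log_lt_log ha (h'.lt_left hF ha hA hl' hm')
    have h2 := Real.log_neg (hl'.trans_le hll) hl
    simp
    linarith
  | succ j ih =>
    intro l m l' m' hl' hll hl hm hmm hm' h h'
    have hl0 := hl'.trans_le hll
    have hm0 := hm.trans_le hmm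
    obtain ⟨k1, hk⟩ := h.pred hF hl0 hl hm (hmm.trans_lt hm')
    obtain ⟨k1', hk'⟩ := h'.pred hF hl' (hll.trans_lt hl) hm0 hm'
    have hP := hF.iterate (j + 1)
    have hQ := isProfile_top.iterate (j + 1)
    have p := pullScale_pos hP hQ hl0 hm
    have hcA := hP.coarea_pos
    have hcB := hQ.coarea_pos
    have hle : pullScale (opT^[j + 1] F) (opT^[j + 1] top) l m ≤
        pullScale (opT^[j + 1] F) (opT^[j + 1] top) l' m' := by
      unfold pullScale; gcongr
    -- The two pairs exchange roles: the pair with the smaller `l` has the larger pulled scale. Its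
    -- logarithmic excess is the sum of the two old differences, whence the Fibonacci coefficients.
    have := ih _ _ _ _ p hle k1' hl' hll hl hk' hk
    have e : ∀ l m, 0 < l → 0 < m → Real.log (pullScale (opT^[j + 1] F) (opT^[j + 1] top) l m) =
        Real.log m + Real.log (coarea (opT^[j + 1] F)) -
          (Real.log (coarea (opT^[j + 1] top)) + Real.log l) := by
      intro l m hl hm
      unfold pullScale
      rw [Real.log_div (by positivity) (by positivity), Real.log_mul hm.ne' hcA.ne',
        Real.log_mul hcB.ne' hl.ne']
    rw [e _ _ hl' hm0, e _ _ hl0 hm] at this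
    rw [show j + 1 + 1 = j + 2 from rfl, Nat.fib_add_two]
    push_cast
    linarith

lemma eventually_mul_iterate_top_le (hF : IsProfile F) {p : ℝ} (hp : 0 < p) (hp1 : p < 1) :
    ∀ᶠ n in atTop, ∀ x, 0 ≤ x → p * opT^[n] top (x / p) ≤ opT^[n] F x := by
  obtain ⟨a, ha, hA⟩ := exists_le_coarea_iterate hF
  obtain ⟨q, hpq, hq1⟩ := exists_between hp1
  have hd : 0 < Real.log q - Real.log p := sub_pos.2 (Real.log_lt_log hp hpq)
  obtain ⟨N, hN⟩ := exists_nat_gt (-Real.log a / (Real.log q - Real.log p))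
  rw [eventually_atTop]
  refine ⟨N + 5 + 1, fun n hn => ?_⟩
  obtain ⟨j, rfl⟩ : ∃ j, n = j + 1 := ⟨n - 1, by omega⟩
  by_contra! hcon
  obtain ⟨x, hx, h⟩ := hcon
  have hpos : 0 < opT^[j + 1] top (x / p) := by
    have := (hF.iterate (j + 1)).nonneg hx
    by_contra! hcon
    have := mul_nonpos_of_nonneg_of_nonpos hp.le hcon
    linarith
  -- Raising only the vertical scale from `p` to `q` gives a second bad pair at a fixed logarithmic
  -- distance, which the growth of `Nat.fib` excludes.
  have h' : FallsBelow F (j + 1) p q :=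
    ⟨x, hx, h.trans (mul_lt_mul_of_pos_right hpq hpos)⟩
  have := fib_mul_log_le hF ha hA j p p p q hp le_rfl hp1 hp hpq.le hq1
    ⟨x, hx, h⟩ h'
  rw [sub_self, mul_zero, zero_add] at this
  have hfib : (N : ℝ) ≤ Nat.fib j := by
    exact_mod_cast le_trans (by omega) (Nat.le_fib_self (by omega : 5 ≤ j))
  rw [div_lt_iff₀ hd] at hN
  have := mul_le_mul_of_nonneg_right hfib hd.le
  linarith

lemma iterate_top_sub_le {b : ℝ} (hb : 0 < b) (hB : ∀ n, b ≤ coarea (opT^[n] top)) {n : ℕ}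
    (hn : 1 ≤ n) {x y : ℝ} (hxy : x ≤ y) :
    opT^[n] top x - opT^[n] top y ≤ (y - x) / b := by
  obtain ⟨n, rfl⟩ : ∃ k, n = k + 1 := ⟨n - 1, by omega⟩
  rw [Function.iterate_succ_apply']
  refine (opT_sub_le (isProfile_top.iterate n).coarea_pos hxy).trans ?_
  exact div_le_div_of_nonneg_left (by linarith) hb (hB n)

lemma eventually_abs_sub_iterate_top_lt (hF : IsProfile F) {ε : ℝ} (hε : 0 < ε) :
    ∀ᶠ n in atTop, ∀ x ∈ I01, |opT^[n] top x - opT^[n] F x| < ε := by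
  obtain ⟨b, hb, hB⟩ := exists_le_coarea_iterate isProfile_top
  have hc : ContinuousAt (fun p : ℝ => (1 - p) + (1 / p - 1) / b) 1 := by
    fun_prop (disch := norm_num)
  have hlim : Tendsto (fun p : ℝ => (1 - p) + (1 / p - 1) / b) (𝓝[<] 1) (𝓝 0) := by
    have := hc.tendsto.mono_left (nhdsWithin_le_nhds (s := Iio 1))
    simpa using this
  obtain ⟨p, hpε, hp, hp1⟩ := ((hlim.eventually (gt_mem_nhds hε)).and
    (Ioo_mem_nhdsLT (zero_lt_one' ℝ))).exists
  filter_upwards [eventually_mul_iterate_top_le hF hp hp1, eventually_ge_atTop 1] with n hn hn1 x hx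
  rw [abs_of_nonneg (sub_nonneg.2 (iterate_le_iterate_top hF n hx.1))]
  have hxp : x ≤ x / p := by rw [le_div_iff₀ hp]; nlinarith [hx.1]
  have h1 := iterate_top_sub_le hb hB hn1 hxp
  have h2 := (isProfile_top.iterate n).le_one (div_nonneg hx.1 hp.le)
  have h3 : (x / p - x) / b ≤ (1 / p - 1) / b := by
    have : 0 ≤ 1 / p - 1 := by rw [sub_nonneg, one_le_div hp]; exact hp1.le
    refine div_le_div_of_nonneg_right ?_ hb.le
    rw [show x / p - x = x * (1 / p - 1) by ring]
    exact mul_le_of_le_one_left this hx.2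
  have h4 : (1 - p) * opT^[n] top (x / p) ≤ 1 - p := mul_le_of_le_one_right (by linarith) h2
  linarith [hn x hx.1]

/-! ### The limit of the iterates and its attraction. -/

/-- The limit of the decreasing sequence of iterates of the constant function `1`. -/
noncomputable def limitProfile (x : ℝ) : ℝ := ⨅ n, opT^[n] top x

lemma tendsto_limitProfile {x : ℝ} (hx : 0 ≤ x) :
    Tendsto (fun n => opT^[n] top x) atTop (𝓝 (limitProfile x)) :=
  tendsto_atTop_ciInf (antitone_iterate_top hx)
    ⟨0, by rintro _ ⟨n, rfl⟩; exact (isProfile_top.iterate n).nonneg hx⟩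

lemma isProfile_limitProfile : IsProfile limitProfile where
  anti x hx y hy hxy := le_of_tendsto_of_tendsto' (tendsto_limitProfile hy)
    (tendsto_limitProfile hx) fun n => (isProfile_top.iterate n).anti hx hy hxy
  map_zero := tendsto_nhds_unique (tendsto_limitProfile le_rfl)
    (tendsto_const_nhds.congr fun n => (isProfile_top.iterate n).map_zero.symm)
  vanish x hx := tendsto_nhds_unique (tendsto_limitProfile (by linarith))
    (tendsto_const_nhds.congr fun n => ((isProfile_top.iterate n).vanish x hx).symm)
  near y hy := by
    obtain ⟨b, hb, hB⟩ := exists_le_coarea_iterate isProfile_top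
    have h0 : 0 < (1 - y) * b := mul_pos (by linarith) hb
    refine ⟨(1 - y) * b, h0, ge_of_tendsto (tendsto_limitProfile h0.le) ?_⟩
    filter_upwards [eventually_ge_atTop 1] with n hn
    have := iterate_top_sub_le hb hB hn h0.le
    rw [(isProfile_top.iterate n).map_zero, sub_zero, mul_div_cancel_right₀ _ hb.ne'] at this
    linarith

lemma limitProfile_le_iterate (n : ℕ) {x : ℝ} (hx : 0 ≤ x) : limitProfile x ≤ opT^[n] top x :=
  (antitone_iterate_top hx).le_of_tendsto (tendsto_limitProfile hx) n

/-- No exceptional levels occur: any `x` below all the pseudo-inverses satisfies `y ≤ T^n 1 x` for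
every `n`, a closed condition that survives in the limit. -/
lemma tendsto_pseudoInv_iterate_top (y : ℝ) :
    Tendsto (fun n => pseudoInv (opT^[n] top) y) atTop (𝓝 (pseudoInv limitProfile y)) := by
  have hbdd : BddBelow (range fun n => pseudoInv (opT^[n] top) y) :=
    ⟨0, by rintro _ ⟨n, rfl⟩; exact pseudoInv_nonneg _ _⟩
  have hanti : Antitone fun n => pseudoInv (opT^[n] top) y :=
    antitone_nat_of_succ_le fun n => pseudoInv_mono (fun x hx => iterate_top_succ_le n hx.1) y
  have ht := tendsto_atTop_ciInf hanti hbdd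
  convert ht using 2
  refine le_antisymm (le_ciInf fun n =>
    pseudoInv_mono (fun x hx => limitProfile_le_iterate n hx.1) y) ?_
  by_contra! hcon
  obtain ⟨x, hx1, hx2⟩ := exists_between hcon
  have hx0 : 0 ≤ x := (pseudoInv_nonneg _ _).trans hx1.le
  have hlt : ∀ n, x < pseudoInv (opT^[n] top) y := fun n => hx2.trans_le (ciInf_le hbdd n)
  refine hx1.not_ge (le_pseudoInv ⟨hx0, (hlt 0).le.trans (pseudoInv_le_one _ _)⟩
    (ge_of_tendsto' (tendsto_limitProfile hx0) fun n => ?_))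
  obtain ⟨z, hz, hyz, hxz⟩ := exists_of_lt_pseudoInv hx0 (hlt n)
  exact hyz.trans ((isProfile_top.iterate n).anti hx0 hz.1 hxz.le)

lemma tendsto_integral_pseudoInv_iterate_top (a b : ℝ) :
    Tendsto (fun n => ∫ t in a..b, pseudoInv (opT^[n] top) t) atTop
      (𝓝 (∫ t in a..b, pseudoInv limitProfile t)) := by
  refine intervalIntegral.tendsto_integral_filter_of_dominated_convergence (fun _ => 1)
    (Eventually.of_forall fun n => ?_) (Eventually.of_forall fun n => ?_)
    intervalIntegrable_const ?_
  · exact (antitone_pseudoInv _).measurable.aestronglyMeasurable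
  · refine Eventually.of_forall fun t _ => ?_
    rw [Real.norm_of_nonneg (pseudoInv_nonneg _ _)]
    exact pseudoInv_le_one _ _
  · exact Eventually.of_forall fun t _ => tendsto_pseudoInv_iterate_top t

lemma opT_limitProfile {x : ℝ} (hx : 0 ≤ x) : opT limitProfile x = limitProfile x := by
  refine tendsto_nhds_unique ?_ ((tendsto_add_atTop_iff_nat 1).2 (tendsto_limitProfile hx))
  simp only [Function.iterate_succ_apply']
  exact (tendsto_integral_pseudoInv_iterate_top x 1).div
    (tendsto_integral_pseudoInv_iterate_top 0 1) isProfile_limitProfile.coarea_pos.ne'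

lemma continuousOn_limitProfile : ContinuousOn limitProfile I01 :=
  (continuous_opT limitProfile).continuousOn.congr fun _ hx => (opT_limitProfile hx.1).symm

/-- Dini's theorem. -/
lemma tendstoUniformlyOn_iterate_top :
    TendstoUniformlyOn (fun n => opT^[n] top) limitProfile atTop I01 := by
  refine Antitone.tendstoUniformlyOn_of_forall_tendsto isCompact_Icc (fun n => ?_)
    (fun x hx => antitone_iterate_top hx.1) continuousOn_limitProfile
    fun x hx => tendsto_limitProfile hx.1
  cases n with
  | zero => exact continuousOn_const.congr fun x hx => (eqOn_top hx).symm
  | succ n => rw [Function.iterate_succ_apply']; exact (continuous_opT _).continuousOn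

lemma MemE.tendstoUniformlyOn_iterate {f : ℝ → ℝ} (hf : MemE f) :
    TendstoUniformlyOn (fun n => opT^[n] f) limitProfile atTop I01 := by
  have key : TendstoUniformlyOn (fun n => opT^[n] (opT f)) limitProfile atTop I01 := by
    rw [Metric.tendstoUniformlyOn_iff]
    intro ε hε
    filter_upwards [Metric.tendstoUniformlyOn_iff.1 tendstoUniformlyOn_iterate_top _ (half_pos hε),
      eventually_abs_sub_iterate_top_lt hf.isProfile_opT (half_pos hε)] with n h1 h2 x hx
    have h1 := h1 x hx
    have h2 := h2 x hx
    rw [← Real.dist_eq] at h2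
    linarith [dist_triangle (limitProfile x) (opT^[n] top x) (opT^[n] (opT f) x)]
  intro u hu
  filter_upwards [(tendsto_sub_atTop_nat 1).eventually (key u hu), eventually_ge_atTop 1]
    with n h hn x hx
  have := h x hx
  rwa [← Function.iterate_succ_apply, Nat.succ_eq_add_one, Nat.sub_add_cancel hn] at this

/-! ### Unit stribolas as fixed points of `T`. -/

lemma strictAntiOn_limitProfile : StrictAntiOn limitProfile I01 := by
  intro x hx y hy hxy
  rw [← opT_limitProfile hx.1, ← opT_limitProfile hy.1, ← sub_pos, opT_sub]
  exact div_pos (intervalIntegral.intervalIntegral_pos_of_pos_on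
    (intervalIntegrable_pseudoInv _ x y)
    (fun t ht => isProfile_limitProfile.pseudoInv_pos (ht.2.trans_le hy.2)) hxy)
    isProfile_limitProfile.coarea_pos

lemma limitProfile_one : limitProfile 1 = 0 := by
  rw [← opT_limitProfile zero_le_one, opT_one]

lemma bijOn_limitProfile : BijOn limitProfile I01 I01 := by
  refine ⟨fun x hx => ⟨isProfile_limitProfile.nonneg hx.1, isProfile_limitProfile.le_one hx.1⟩,
    strictAntiOn_limitProfile.injOn, ?_⟩
  have := intermediate_value_Icc' zero_le_one continuousOn_limitProfile
  rwa [limitProfile_one, isProfile_limitProfile.map_zero] at this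

lemma pseudoInv_eq_invFunOn {g : ℝ → ℝ} (hb : BijOn g I01 I01) (ha : AntitoneOn g I01) {y : ℝ}
    (hy : y ∈ I01) : pseudoInv g y = Function.invFunOn g I01 y := by
  have hex := hb.surjOn hy
  have hmem := Function.invFunOn_mem hex
  have heq := Function.invFunOn_eq hex
  refine le_antisymm (Real.sSup_le (fun x hx => ?_) hmem.1) (le_pseudoInv hmem heq.ge)
  by_contra! hlt
  have := ha hmem hx.1 hlt.le
  exact hlt.ne (hb.injOn hmem hx.1 (le_antisymm (heq.le.trans hx.2) this))

/-- A jump of the pseudo-inverse would be a flat piece of `f`. Continuity is what permits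
differentiating the integral in `T` at every point, endpoints included. -/
lemma continuous_pseudoInv {f : ℝ → ℝ} (hf : StrictAntiOn f I01) : Continuous (pseudoInv f) := by
  rw [continuous_iff_continuousAt]
  intro y
  refine tendsto_order.2 ⟨fun a ha => ?_, fun b hb => ?_⟩
  · by_cases h0 : a < 0
    · exact Eventually.of_forall fun t => h0.trans_le (pseudoInv_nonneg f t)
    obtain ⟨x, hx, hyx, hax⟩ := exists_of_lt_pseudoInv (not_lt.1 h0) ha
    obtain ⟨c, hac, hcx⟩ := exists_between hax
    have hc : c ∈ I01 := ⟨(not_lt.1 h0).trans hac.le, hcx.le.trans hx.2⟩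
    filter_upwards [gt_mem_nhds (hyx.trans_lt (hf hc hx hcx))] with t ht
    exact hac.trans_le (le_pseudoInv hc ht.le)
  · by_cases h1 : 1 < b
    · exact Eventually.of_forall fun t => (pseudoInv_le_one f t).trans_lt h1
    obtain ⟨c, hyc, hcb⟩ := exists_between hb
    have hc : c ∈ I01 := ⟨(pseudoInv_nonneg f y).trans hyc.le, hcb.le.trans (not_lt.1 h1)⟩
    have hfc : f c < y := by
      by_contra! hcon
      exact hyc.not_ge (le_pseudoInv hc hcon)
    filter_upwards [lt_mem_nhds hfc] with t ht
    refine lt_of_le_of_lt (Real.sSup_le (fun x hx => ?_) hc.1) hcb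
    by_contra! hlt
    exact absurd (hf hc hx.1 hlt) (by linarith [hx.2])

lemma hasDerivWithinAt_limitProfile {x : ℝ} (hx : x ∈ I01) :
    HasDerivWithinAt limitProfile (-pseudoInv limitProfile x / coarea limitProfile) I01 x := by
  have hc := continuous_pseudoInv strictAntiOn_limitProfile
  have := (intervalIntegral.integral_hasDerivAt_left (hc.intervalIntegrable x 1)
    (hc.stronglyMeasurableAtFilter _ _) hc.continuousAt).div_const (coarea limitProfile)
  exact this.hasDerivWithinAt.congr_of_mem (fun y hy => (opT_limitProfile hy.1).symm) hx

lemma isUnitStribola_limitProfile : IsUnitStribola limitProfile where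
  bijOn := bijOn_limitProfile
  differentiableOn _ hx := (hasDerivWithinAt_limitProfile hx).differentiableWithinAt
  eqn := ⟨coarea limitProfile, isProfile_limitProfile.coarea_pos, fun x hx => by
    rw [(hasDerivWithinAt_limitProfile hx).derivWithin (uniqueDiffOn_Icc zero_lt_one x hx),
      ← pseudoInv_eq_invFunOn bijOn_limitProfile strictAntiOn_limitProfile.antitoneOn hx]
    field_simp [isProfile_limitProfile.coarea_pos.ne']⟩

lemma memE_of_bijOn {g : ℝ → ℝ} (hb : BijOn g I01 I01) (ha : AntitoneOn g I01)
    (hc : ContinuousOn g I01) : MemE g ∧ g 1 = 0 := by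
  have m0 : (0 : ℝ) ∈ I01 := ⟨le_rfl, zero_le_one⟩
  have m1 : (1 : ℝ) ∈ I01 := ⟨zero_le_one, le_rfl⟩
  obtain ⟨x, hx, hx1⟩ := hb.surjOn m1
  obtain ⟨y, hy, hy0⟩ := hb.surjOn m0
  have g0 : g 0 = 1 := le_antisymm (hb.mapsTo m0).2 (hx1 ▸ ha m0 hx hx.1)
  have g1 : g 1 = 0 := le_antisymm (hy0 ▸ ha hy m1 hy.2) (hb.mapsTo m1).1
  refine ⟨⟨fun z hz => (hb.mapsTo hz).1, ha, g0, ?_⟩, g1⟩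
  refine intervalIntegral.intervalIntegral_pos_of_pos_on
    (hc.intervalIntegrable_of_Icc zero_le_one) (fun z hz => ?_) zero_lt_one
  have hz' : z ∈ I01 := ⟨hz.1.le, hz.2.le⟩
  refine (hb.mapsTo hz').1.lt_of_ne fun h0 => hz.2.ne (hb.injOn hz' m1 ?_)
  rw [← h0, g1]

/-- The equation forces `g' ≤ 0`, so `g` is decreasing and `g⁻¹` is its pseudo-inverse. Integrating
from `x` to `1` gives `γ * g x`, and `γ` cancels in the quotient defining `T`. -/
lemma IsUnitStribola.memE_and_opT_eqOn {g : ℝ → ℝ} (hg : IsUnitStribola g) :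
    MemE g ∧ EqOn (opT g) g I01 := by
  obtain ⟨γ, hγ, heq⟩ := hg.eqn
  have hc := hg.differentiableOn.continuousOn
  have hd : ∀ x ∈ Ioo (0 : ℝ) 1, HasDerivAt g (-Function.invFunOn g I01 x / γ) x := by
    intro x hx
    have hxI : x ∈ I01 := ⟨hx.1.le, hx.2.le⟩
    have := (hg.differentiableOn x hxI).hasDerivWithinAt.hasDerivAt (Icc_mem_nhds hx.1 hx.2)
    rwa [show -Function.invFunOn g I01 x / γ = derivWithin g I01 x by
      rw [← heq x hxI]; field_simp]
  have ha : AntitoneOn g I01 := by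
    refine antitoneOn_of_deriv_nonpos (convex_Icc 0 1) hc
      (hg.differentiableOn.mono interior_subset) fun x hx => ?_
    replace hx : x ∈ Ioo (0 : ℝ) 1 := interior_Icc.subset hx
    rw [(hd x hx).deriv]
    have := (Function.invFunOn_mem (hg.bijOn.surjOn (⟨hx.1.le, hx.2.le⟩ : x ∈ I01))).1
    exact div_nonpos_of_nonpos_of_nonneg (by linarith) hγ.le
  obtain ⟨hE, h1⟩ := memE_of_bijOn hg.bijOn ha hc
  have hint : ∀ x ∈ I01, ∫ t in x..1, pseudoInv g t = γ * g x := by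
    intro x hx
    have := intervalIntegral.integral_eq_sub_of_hasDerivAt_of_le
      (f' := fun t => -pseudoInv g t / γ) hx.2 (hc.mono (Icc_subset_Icc_left hx.1))
      (fun t ht => by
        have ht' : t ∈ Ioo (0 : ℝ) 1 := ⟨hx.1.trans_lt ht.1, ht.2⟩
        rw [pseudoInv_eq_invFunOn hg.bijOn ha ⟨ht'.1.le, ht'.2.le⟩]
        exact hd t ht')
      ((intervalIntegrable_pseudoInv g x 1).neg.div_const γ)
    rw [intervalIntegral.integral_div, intervalIntegral.integral_neg, h1,
      div_eq_iff hγ.ne'] at this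
    linarith
  refine ⟨hE, fun x hx => ?_⟩
  rw [opT_apply, coarea, area, hint x hx, hint 0 ⟨le_rfl, zero_le_one⟩, hE.map_zero, mul_one,
    mul_div_cancel_left₀ _ hγ.ne']

lemma IsUnitStribola.eqOn_limitProfile {g : ℝ → ℝ} (hg : IsUnitStribola g) :
    EqOn g limitProfile I01 := by
  obtain ⟨hE, hT⟩ := hg.memE_and_opT_eqOn
  have hiter : ∀ n, EqOn (opT^[n] g) g I01 := by
    intro n
    induction n with
    | zero => exact eqOn_refl _ _
    | succ n ih => rw [Function.iterate_succ_apply', opT_congr ih]; exact hT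
  intro x hx
  exact tendsto_nhds_unique (tendsto_const_nhds.congr fun n => (hiter n hx).symm)
    (hE.tendstoUniformlyOn_iterate.tendsto_at hx)

lemma memE_one : MemE fun _ => 1 where
  nonneg _ _ := zero_le_one
  antitone := antitoneOn_const
  map_zero := rfl
  area_pos := by simp [area]

end Stribola

theorem mainTheorem4 :
    ∃ h : ℝ → ℝ,
      -- `h` is the unit stribola (existence and uniqueness)
      Stribola.IsUnitStribola h ∧
      (∀ g : ℝ → ℝ, Stribola.IsUnitStribola g → Set.EqOn g h Stribola.I01) ∧
      -- it is a fixed point of `T` in the class on which `T` acts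
      Stribola.MemE h ∧ Set.EqOn (Stribola.opT h) h Stribola.I01 ∧
      -- it is the limit of the canonical iterates `Tⁿ 1`
      TendstoUniformlyOn (fun n : ℕ => Stribola.opT^[n] (fun _ => 1)) h Filter.atTop
        Stribola.I01 ∧
      -- global convergence
      ∀ f : ℝ → ℝ, Stribola.MemE f →
        TendstoUniformlyOn (fun n : ℕ => Stribola.opT^[n] f) h Filter.atTop Stribola.I01 :=
  ⟨Stribola.limitProfile, Stribola.isUnitStribola_limitProfile,
    fun _ hg => hg.eqOn_limitProfile,
    Stribola.isUnitStribola_limitProfile.memE_and_opT_eqOn.1,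
    Stribola.isUnitStribola_limitProfile.memE_and_opT_eqOn.2,
    Stribola.memE_one.tendstoUniformlyOn_iterate,
    fun _ hf => hf.tendstoUniformlyOn_iterate⟩
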